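/- **Setting.** Consider the triangular grid of the plane. Its edges are directed so that the three sides of every unit triangle form a directed 3-cycle ("positive direction"; all parallel edges have the same direction). A *domain* $\mathcal D$ is a finite union of unit triangles; its *contour* is the set of grid edges belonging to exactly one of its triangles. A *lozenge* is the union of two triangles with a common side; a *tiling* of $\mathcal D$ is a set of lozenges with pairwise disjoint interiors whose union is $\mathcal D$. A *height function* of a tiling $T$ is a function $h$ from the vertices of $\mathcal D$ to $\mathbb Z$ that increases by $1$ along every positively directed edge of $\mathcal D$ not cutting a lozenge of $T$ (hence decreases by $2$ along the other ones). We assume that $\mathcal D$ is tileable and that the lattice theory of its tilings applies, i.e. that height functions are consistent: any two tilings of $\mathcal D$ have height functions that agree on the contour of $\mathcal D$ (this holds if $\mathcal D$ is simply connected). Tilings are ordered by $T\preccurlyeq T'$ iff $h_T\le h_{T'}$ for height functions $h_T,h_{T'}$ agreeing on the contour; there are then a minimal and a maximal tiling. A vertex of $\mathcal D$ is *solid* if it has the same height in both (heights agreeing on the contour). **Definitions.** - A *$T$-valid cycle* in $\mathcal D$ is either a single vertex or a closed repetition-free path along edges of $\mathcal D$ with $|h_T(v)-h_T(v')|=1$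 for consecutive vertices $v,v'$. A *sub-domain* of $\mathcal D$ is a part $F\subseteq\mathcal D$, union of triangles, whose contour is a $T$-valid cycle for some tiling $T$ of $\mathcal D$ (the case of a single vertex corresponding to an $F$ without triangles). - A *fracture line* of $\mathcal D$ is a $T$-valid cycle (for some tiling $T$ of $\mathcal D$) all of whose vertices are solid. - A *fracture zone* of $\mathcal D$ is a sub-domain, not reduced to a point, whose contour is a fracture line $L$ and which contains no other fracture line, apart from those reduced to a single vertex. - A sub-domain $F$ of $\mathcal D$ is *pre-fertile* if it is connected and tileable, at least one of its vertices is not on its contour, no vertex of $F$ off its contour is solid in $\mathcal D$, and two vertices of its contour are joined by a grid edge contained in $F$ if and only if they are neighbours on the contour. It is *fertile* if it is pre-fertile and maximal for fertile union: for every pre-fertile sub-domain $F'$ such that $F\cup F'$ is a pre-fertile sub-domain, $F\cup F'=F$. **Theorem (Fracture theorem).** Every fracture zone of $\mathcal D$ is either a fertile zone (a fertile sub-domain of $\mathcal D$) or a single lozenge. -/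

import Mathlib

namespace Lozenge

/-- Vertices of the triangular grid: `(i, j)` stands for the point `i • e₁ + j • e₂` of the plane,
where `e₁`, `e₂` are unit vectors at an angle of 60 degrees. -/
abbrev Vertex := ℤ × ℤ

/-- `PosStep u v`: the grid edge from `u` to `v` is positively directed, i.e. labelled by one of
the letters `a = e₁`, `b = e₂ - e₁`, `c = -e₂`. These satisfy `a + b + c = 0`, and each unit
triangle is bounded by one edge of each label, forming a directed 3-cycle. -/
def PosStep (u v : Vertex) : Prop :=
  v = u + (1, 0) ∨ v = u + (-1, 1) ∨ v = u + (0, -1)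

/-- The triangular grid, as a graph. -/
def grid : SimpleGraph Vertex := SimpleGraph.fromRel PosStep

/-- Unit triangles of the grid: `(p, true)` has corners `p, p + e₁, p + e₂`, and
`(p, false)` has corners `p + e₁, p + e₂, p + e₁ + e₂`. -/
abbrev Triangle := Vertex × Bool

namespace Triangle

/-- The three corners of a triangle. -/
def corners (t : Triangle) : Finset Vertex :=
  if t.2 then {t.1, t.1 + (1, 0), t.1 + (0, 1)}
  else {t.1 + (1, 0), t.1 + (0, 1), t.1 + (1, 1)}

/-- The three sides of a triangle. -/
def sides (t : Triangle) : Finset (Sym2 Vertex) :=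
  if t.2 then {s(t.1, t.1 + (1, 0)), s(t.1 + (1, 0), t.1 + (0, 1)), s(t.1 + (0, 1), t.1)}
  else {s(t.1 + (1, 0), t.1 + (0, 1)), s(t.1 + (0, 1), t.1 + (1, 1)),
    s(t.1 + (1, 1), t.1 + (1, 0))}

/-- Two distinct triangles are adjacent when they have a common side. -/
def adjacency : SimpleGraph Triangle :=
  SimpleGraph.fromRel fun t t' => ∃ e, e ∈ t.sides ∧ e ∈ t'.sides

end Triangle

/-- A domain is a finite union of triangles of the grid. -/
abbrev Domain := Finset Triangle

namespace Domain

/-- The vertices of a domain. -/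
def vertices (D : Domain) : Finset Vertex := D.biUnion Triangle.corners

/-- The grid edges contained in a domain. -/
def edges (D : Domain) : Finset (Sym2 Vertex) := D.biUnion Triangle.sides

/-- The contour of a domain: the edges that belong to exactly one of its triangles. -/
def contour (D : Domain) : Set (Sym2 Vertex) := {e | ∃! t, t ∈ D ∧ e ∈ t.sides}

/-- The vertices on the contour of a domain. -/
def contourVertices (D : Domain) : Set Vertex := {v | ∃ e ∈ D.contour, v ∈ e}

/-- Connectedness of a domain: any two of its triangles are joined by a chain of triangles of the
domain in which consecutive triangles have a common side. -/
def IsConnected (D : Domain) : Prop :=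
  (Triangle.adjacency.induce (D : Set Triangle)).Connected

end Domain

/-- A lozenge is the union of two distinct triangles with a common side. -/
def IsLozenge (F : Domain) : Prop :=
  ∃ t t' : Triangle, Triangle.adjacency.Adj t t' ∧ F = {t, t'}

/-- `T` is a tiling of `D`: a set of lozenges with pairwise disjoint interiors whose union
is `D`. -/
def IsTiling (D : Domain) (T : Finset Domain) : Prop :=
  (∀ l ∈ T, IsLozenge l) ∧ (T : Set Domain).PairwiseDisjoint id ∧ T.biUnion id = D

/-- A domain is tileable if it admits a tiling. -/
def IsTileable (D : Domain) : Prop := ∃ T, IsTiling D T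

/-- The edge `e` cuts the interior of a lozenge of `T`, i.e. it is the common side of the two
triangles of that lozenge. -/
def CutsTile (T : Finset Domain) (e : Sym2 Vertex) : Prop :=
  ∃ l ∈ T, ∀ t ∈ l, e ∈ t.sides

/-- `h` is a height function of the tiling `T` of `D`: the height increases by `1` along each
positively directed edge of `D` that does not cut a lozenge of `T`. (The values of `h` outside
the vertices of `D` are irrelevant.) -/
def IsHeight (D : Domain) (T : Finset Domain) (h : Vertex → ℤ) : Prop :=
  ∀ u v, PosStep u v → s(u, v) ∈ D.edges → ¬ CutsTile T s(u, v) → h v = h u + 1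

/-- `h` and `h'` are height functions of the tilings `T` and `T'` of `D` that take the same values
on the contour of `D`, so that they can be compared. -/
def AreNormalizedHeights (D : Domain) (T T' : Finset Domain) (h h' : Vertex → ℤ) : Prop :=
  IsHeight D T h ∧ IsHeight D T' h' ∧ ∀ v ∈ D.contourVertices, h v = h' v

/-- The standing assumption on domains (satisfied by all simply connected ones) under which the
tilings form a distributive lattice connected by flips: every tiling has a height function, and
the heights on the contour do not depend on the tiling. -/
def HasConsistentHeights (D : Domain) : Prop :=
  ∀ T T', IsTiling D T → IsTiling D T' → ∃ h h', AreNormalizedHeights D T T' h h'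

/-- The order on the tilings of `D` given by the height functions. -/
def TilingLE (D : Domain) (T T' : Finset Domain) : Prop :=
  ∃ h h', AreNormalizedHeights D T T' h h' ∧ ∀ v ∈ D.vertices, h v ≤ h' v

/-- `T` is the minimal tiling of `D`. -/
def IsMinimalTiling (D : Domain) (T : Finset Domain) : Prop :=
  IsTiling D T ∧ ∀ T', IsTiling D T' → TilingLE D T T'

/-- `T` is the maximal tiling of `D`. -/
def IsMaximalTiling (D : Domain) (T : Finset Domain) : Prop :=
  IsTiling D T ∧ ∀ T', IsTiling D T' → TilingLE D T' T

/-- A vertex of `D` is solid if it has the same height in the minimal and in the maximal tiling. -/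
def IsSolid (D : Domain) (v : Vertex) : Prop :=
  v ∈ D.vertices ∧ ∃ Tmin Tmax hmin hmax, IsMinimalTiling D Tmin ∧ IsMaximalTiling D Tmax ∧
    AreNormalizedHeights D Tmin Tmax hmin hmax ∧ hmin v = hmax v

/-- The closed path `C` lies in the domain `F`. -/
def LiesIn {v : Vertex} (C : grid.Walk v v) (F : Domain) : Prop :=
  v ∈ F.vertices ∧ ∀ e ∈ C.edges, e ∈ F.edges

/-- `C` is a `T`-valid cycle in `D`: a closed repetition-free path in `D`, possibly reduced to a
single vertex, along each edge of which the height of `T` varies by `1` in absolute value. -/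
def IsValidCycle (D : Domain) (T : Finset Domain) {v : Vertex} (C : grid.Walk v v) : Prop :=
  LiesIn C D ∧ (C.Nil ∨ C.IsCycle) ∧
    ∃ h, IsHeight D T h ∧ ∀ d ∈ C.darts, |h d.snd - h d.fst| = 1

/-- The contour of `F` is the closed path `C` (the domain without triangles being delimited by the
paths that are reduced to a single point). -/
def IsDelimitedBy (F : Domain) {v : Vertex} (C : grid.Walk v v) : Prop :=
  F.contour = {e | e ∈ C.edges}

/-- A sub-domain of `D` is a part of `D` delimited by a `T`-valid cycle for some tiling `T`
of `D`. -/
def IsSubDomain (D F : Domain) : Prop :=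
  F ⊆ D ∧ ∃ T, IsTiling D T ∧ ∃ (v : Vertex) (C : grid.Walk v v),
    IsValidCycle D T C ∧ IsDelimitedBy F C

/-- A fracture line of `D`: a `T`-valid cycle in `D`, for some tiling `T` of `D`, composed only of
solid vertices. -/
def IsFractureLine (D : Domain) {v : Vertex} (C : grid.Walk v v) : Prop :=
  (∃ T, IsTiling D T ∧ IsValidCycle D T C) ∧ ∀ x ∈ C.support, IsSolid D x

/-- A fracture zone of `D`: a sub-domain not reduced to a single point (so, containing a
triangle), delimited by a fracture line and containing no other fracture line. Two closed paths
are regarded as the same line when they have the same edges; the fracture lines reduced to a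
single vertex, of which the vertices on the contour are always examples, are not counted. -/
def IsFractureZone (D F : Domain) : Prop :=
  IsSubDomain D F ∧ F.Nonempty ∧ ∃ (v : Vertex) (L : grid.Walk v v),
    IsFractureLine D L ∧ IsDelimitedBy F L ∧
    ∀ (w : Vertex) (C : grid.Walk w w), IsFractureLine D C → ¬ C.Nil → LiesIn C F →
      ∀ e, e ∈ C.edges ↔ e ∈ L.edges

/-- A pre-fertile sub-domain of `D`: it is connected and tileable, it has a vertex that is not on
its contour, no such vertex is solid in `D`, and two vertices of its contour are joined by a grid
edge contained in it if and only if they are neighbours on the contour. -/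
def IsPreFertile (D F : Domain) : Prop :=
  IsSubDomain D F ∧ F.IsConnected ∧ IsTileable F ∧
    (∃ v ∈ F.vertices, v ∉ F.contourVertices) ∧
    (∀ v ∈ F.vertices, v ∉ F.contourVertices → ¬ IsSolid D v) ∧
    (∀ u ∈ F.contourVertices, ∀ v ∈ F.contourVertices,
      s(u, v) ∈ F.edges ↔ s(u, v) ∈ F.contour)

/-- A fertile zone of `D`: a pre-fertile sub-domain that is maximal for fertile union, i.e. its
union with another pre-fertile sub-domain is never a strictly larger pre-fertile sub-domain. -/
def IsFertile (D F : Domain) : Prop :=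
  IsPreFertile D F ∧ ∀ F', IsPreFertile D F' → IsPreFertile D (F ∪ F') → F ∪ F' = F

end Lozenge

/-! Consider the graph of the edges of a fracture zone `F` whose ends are solid and along which the
height of the maximal tiling varies by 1. Variations between solid vertices do not depend on the
tiling, so every cycle of this graph is a fracture line inside `F`. By uniqueness it has the edges
of the contour `L`, hence every edge outside `L` is a bridge. Three consequences follow.

No solid vertex is off the contour of `F`. Extremality forbids flips, so such a vertex has a lower
neighbour (maximal tiling) and an upper one (minimal tiling), both solid. Descending and ascending
in this way leads to the contour at both ends, and `L` closes a cycle through an edge outside `L`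
(`reachable_of_interior`).

A chord of the contour cannot vary by 1, since `L` would again close a cycle. It is therefore cut by
a tile whose four sides form a cycle of solid edges; this cycle has the edges of `L`, and `F` is
that lozenge. Without chords, `F` is pre-fertile (`IsFractureZone.isPreFertile_or_isLozenge`).

Maximality: the contour of `F` is solid, so in a pre-fertile `G ⊇ F` it can neither enter the
interior of `G` nor follow a chord of `G`. It lies on the contour of `G`, a single cycle, whence `F
= G` (`IsFractureZone.eq_of_isPreFertile`). -/

namespace Lozenge

/-! ### Incidences in the triangular grid, and contours. -/

section Geometry

lemma PosStep.cases {u v : Vertex} (h : PosStep u v) :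
    (v.1 = u.1 + 1 ∧ v.2 = u.2) ∨ (v.1 = u.1 - 1 ∧ v.2 = u.2 + 1) ∨
      (v.1 = u.1 ∧ v.2 = u.2 - 1) := by
  rcases h with rfl | rfl | rfl <;> simp <;> omega

lemma PosStep.ne {u v : Vertex} (h : PosStep u v) : u ≠ v := by
  rintro rfl
  have := h.cases
  omega

lemma PosStep.adj {u v : Vertex} (h : PosStep u v) : grid.Adj u v :=
  ⟨h.ne, Or.inl h⟩

/-- The triangle pointing up that has the grid edge `u v` as a side. -/
def upper (u v : Vertex) : Triangle := (u ⊓ v, true)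

/-- The triangle pointing down that has the grid edge `u v` as a side. -/
def lower (u v : Vertex) : Triangle := (u ⊔ v - (1, 1), false)

lemma upper_ne_lower (u v u' v' : Vertex) : upper u v ≠ lower u' v' := by
  simp [upper, lower]

/-- Meet and join of the ends locate the two triangles uniformly in the three directions. Incidence
questions thus become membership of two explicit triangles. -/
lemma mem_sides_iff {u v : Vertex} (h : PosStep u v) (t : Triangle) :
    s(u, v) ∈ t.sides ↔ t = upper u v ∨ t = lower u v := by
  obtain ⟨⟨p, q⟩, b⟩ := t
  obtain ⟨a, c⟩ := u
  obtain ⟨a', c'⟩ := v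
  rcases h with h | h | h <;> simp only [Prod.mk_add_mk, Prod.mk.injEq] at h <;>
    obtain ⟨rfl, rfl⟩ := h <;> cases b <;>
    simp [Triangle.sides, upper, lower] <;> omega

/-- The sides of a triangle form a directed 3-cycle. -/
lemma exists_posStep_of_mem_sides {t : Triangle} {e : Sym2 Vertex} (h : e ∈ t.sides) :
    ∃ u v w, e = s(u, v) ∧ PosStep u v ∧ PosStep v w ∧ PosStep w u ∧
      s(v, w) ∈ t.sides ∧ s(w, u) ∈ t.sides := by
  obtain ⟨⟨p, q⟩, b⟩ := t
  cases b
  · simp only [Triangle.sides, Bool.false_eq_true, if_false, Finset.mem_insert,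
      Finset.mem_singleton] at h ⊢
    rcases h with rfl | rfl | rfl
    · exact ⟨_, _, (p, q) + (1, 1), rfl, by simp [PosStep], by simp [PosStep],
        by simp [PosStep], by simp, by simp⟩
    · exact ⟨_, _, (p, q) + (1, 0), rfl, by simp [PosStep], by simp [PosStep],
        by simp [PosStep], by simp, by simp⟩
    · exact ⟨_, _, (p, q) + (0, 1), rfl, by simp [PosStep], by simp [PosStep],
        by simp [PosStep], by simp, by simp⟩
  · simp only [Triangle.sides, if_true, Finset.mem_insert,
      Finset.mem_singleton] at h ⊢
    rcases h with rfl | rfl | rfl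
    · exact ⟨_, _, (p, q) + (0, 1), rfl, by simp [PosStep], by simp [PosStep],
        by simp [PosStep], by simp, by simp⟩
    · exact ⟨_, _, (p, q), rfl, by simp [PosStep], by simp [PosStep],
        by simp [PosStep], by simp, by simp⟩
    · exact ⟨_, _, (p, q) + (1, 0), rfl, by simp [PosStep], by simp [PosStep],
        by simp [PosStep], by simp, by simp⟩

lemma mem_corners_of_mem_sides {t : Triangle} {e : Sym2 Vertex} (h : e ∈ t.sides) {v : Vertex}
    (hv : v ∈ e) : v ∈ t.corners := by
  obtain ⟨⟨p, q⟩, b⟩ := t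
  cases b <;> simp [Triangle.sides, Triangle.corners] at h ⊢ <;>
    rcases h with rfl | rfl | rfl <;> simp at hv <;> tauto

lemma mem_edges_iff {D : Domain} {u v : Vertex} (h : PosStep u v) :
    s(u, v) ∈ D.edges ↔ upper u v ∈ D ∨ lower u v ∈ D := by
  simp only [Domain.edges, Finset.mem_biUnion, mem_sides_iff h]
  constructor
  · rintro ⟨t, ht, rfl | rfl⟩ <;> tauto
  · rintro (ht | ht)
    exacts [⟨_, ht, Or.inl rfl⟩, ⟨_, ht, Or.inr rfl⟩]

lemma mem_contour_iff {D : Domain} {u v : Vertex} (h : PosStep u v) :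
    s(u, v) ∈ D.contour ↔ Xor (upper u v ∈ D) (lower u v ∈ D) := by
  simp only [Domain.contour, Set.mem_ofPred_eq, mem_sides_iff h]
  have hne := upper_ne_lower u v u v
  constructor
  · rintro ⟨t, ⟨ht, h1 | h1⟩, hu⟩
    · subst h1
      exact Or.inl ⟨ht, fun h2 => hne (hu _ ⟨h2, Or.inr rfl⟩).symm⟩
    · subst h1
      exact Or.inr ⟨ht, fun h2 => hne (hu _ ⟨h2, Or.inl rfl⟩)⟩
  · rintro (⟨h1, h2⟩ | ⟨h1, h2⟩)
    · refine ⟨_, ⟨h1, Or.inl rfl⟩, ?_⟩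
      rintro _ ⟨h3, rfl | rfl⟩
      exacts [rfl, absurd h3 h2]
    · refine ⟨_, ⟨h1, Or.inr rfl⟩, ?_⟩
      rintro _ ⟨h3, rfl | rfl⟩
      exacts [absurd h3 h2, rfl]

lemma contour_subset_edges {D : Domain} {e : Sym2 Vertex} (h : e ∈ D.contour) : e ∈ D.edges := by
  obtain ⟨t, ⟨ht, he⟩, -⟩ := h
  exact Finset.mem_biUnion.2 ⟨t, ht, he⟩

lemma exists_posStep_of_mem_edges {D : Domain} {e : Sym2 Vertex} (h : e ∈ D.edges) :
    ∃ u v, e = s(u, v) ∧ PosStep u v := by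
  obtain ⟨t, -, he⟩ := Finset.mem_biUnion.1 h
  obtain ⟨u, v, -, h1, h2, -⟩ := exists_posStep_of_mem_sides he
  exact ⟨u, v, h1, h2⟩

lemma mem_vertices_of_mem_edges {D : Domain} {e : Sym2 Vertex} (h : e ∈ D.edges) {v : Vertex}
    (hv : v ∈ e) : v ∈ D.vertices := by
  obtain ⟨t, ht, he⟩ := Finset.mem_biUnion.1 h
  exact Finset.mem_biUnion.2 ⟨t, ht, mem_corners_of_mem_sides he hv⟩

lemma edges_mono {D E : Domain} (h : D ⊆ E) : D.edges ⊆ E.edges :=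
  Finset.biUnion_subset_biUnion_of_subset_left _ h

lemma vertices_mono {D E : Domain} (h : D ⊆ E) : D.vertices ⊆ E.vertices :=
  Finset.biUnion_subset_biUnion_of_subset_left _ h

/-- Two triangles with two common sides are equal. -/
lemma eq_of_two_common_sides {u v w : Vertex} (huv : PosStep u v) (hvw : PosStep v w)
    (hwu : PosStep w u) {t t' : Triangle}
    (h1 : s(u, v) ∈ t.sides) (h2 : s(v, w) ∈ t.sides) (h3 : s(u, v) ∈ t'.sides)
    (h4 : s(v, w) ∈ t'.sides) : t = t' := by
  rw [mem_sides_iff huv] at h1 h3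
  rw [mem_sides_iff hvw] at h2 h4
  have n1 := upper_ne_lower u v v w
  have n2 := upper_ne_lower v w u v
  rcases h1 with rfl | rfl <;> rcases h3 with rfl | rfl <;> try rfl
  · rcases h2 with h2 | h2 <;> rcases h4 with h4 | h4 <;>
      simp_all [upper, lower, Prod.ext_iff]
    have := huv.cases; have := hvw.cases; have := hwu.cases
    omega
  · rcases h2 with h2 | h2 <;> rcases h4 with h4 | h4 <;>
      simp_all [upper, lower, Prod.ext_iff]
    have := huv.cases; have := hvw.cases; have := hwu.cases
    omega

/-- The six edges at a vertex and the triangles they bound. -/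
lemma contour_at {D : Domain} (v : Vertex) :
    (s(v, v + (1, 0)) ∈ D.contour ↔ Xor ((v, true) ∈ D) ((v - (0, 1), false) ∈ D)) ∧
    (s(v + (0, 1), v) ∈ D.contour ↔ Xor ((v, true) ∈ D) ((v - (1, 0), false) ∈ D)) ∧
    (s(v, v + (-1, 1)) ∈ D.contour ↔ Xor ((v - (1, 0), true) ∈ D) ((v - (1, 0), false) ∈ D)) ∧
    (s(v - (1, 0), v) ∈ D.contour ↔ Xor ((v - (1, 0), true) ∈ D) ((v - (1, 1), false) ∈ D)) ∧
    (s(v, v + (0, -1)) ∈ D.contour ↔ Xor ((v - (0, 1), true) ∈ D) ((v - (1, 1), false) ∈ D)) ∧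
    (s(v + (1, -1), v) ∈ D.contour ↔ Xor ((v - (0, 1), true) ∈ D) ((v - (0, 1), false) ∈ D)) := by
  obtain ⟨x, y⟩ := v
  refine ⟨?_, ?_, ?_, ?_, ?_, ?_⟩ <;>
  · rw [mem_contour_iff (by simp [PosStep])]
    simp only [upper, lower, Prod.mk_inf_mk, Prod.mk_sup_mk, Prod.mk_add_mk, Prod.mk_sub_mk]
    congr! 4 <;> simp <;> omega

lemma edge_at_cases {u w v : Vertex} (h : PosStep u w) (hv : v ∈ s(u, w)) :
    s(u, w) = s(v, v + (1, 0)) ∨ s(u, w) = s(v + (0, 1), v) ∨ s(u, w) = s(v, v + (-1, 1)) ∨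
      s(u, w) = s(v - (1, 0), v) ∨ s(u, w) = s(v, v + (0, -1)) ∨ s(u, w) = s(v + (1, -1), v) := by
  rw [Sym2.mem_iff] at hv
  rcases hv with rfl | rfl
  · rcases h with rfl | rfl | rfl <;> simp
  · rcases h with rfl | rfl | rfl
    · right; right; right; left; congr 2; simp
    · right; right; right; right; right; congr 2; simp [add_assoc]
    · right; left; congr 2; simp [add_assoc]

lemma corner_cases {t : Triangle} {v : Vertex} (h : v ∈ t.corners) :
    t = (v, true) ∨ t = (v - (0, 1), false) ∨ t = (v - (1, 0), false) ∨ t = (v - (1, 0), true) ∨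
      t = (v - (1, 1), false) ∨ t = (v - (0, 1), true) := by
  obtain ⟨⟨p, q⟩, b⟩ := t
  obtain ⟨x, y⟩ := v
  cases b <;> simp [Triangle.corners] at h ⊢ <;> omega

/-- All triangles around a vertex off the contour belong to the domain. -/
lemma hexagon_subset {D : Domain} {v : Vertex} (hv : v ∈ D.vertices)
    (hc : v ∉ D.contourVertices) :
    (v, true) ∈ D ∧ (v - (0, 1), false) ∈ D ∧ (v - (1, 0), false) ∈ D ∧ (v - (1, 0), true) ∈ D ∧
      (v - (1, 1), false) ∈ D ∧ (v - (0, 1), true) ∈ D := by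
  obtain ⟨t, ht, htv⟩ := Finset.mem_biUnion.1 hv
  have key : ∀ e, v ∈ e → e ∉ D.contour := fun e he h => hc ⟨e, h, he⟩
  obtain ⟨h1, h2, h3, h4, h5, h6⟩ := contour_at (D := D) v
  have k1 := key s(v, v + (1, 0)) (by simp)
  have k2 := key s(v + (0, 1), v) (by simp)
  have k3 := key s(v, v + (-1, 1)) (by simp)
  have k4 := key s(v - (1, 0), v) (by simp)
  have k5 := key s(v, v + (0, -1)) (by simp)
  have k6 := key s(v + (1, -1), v) (by simp)
  -- Off the contour, membership in `D` is the same for consecutive triangles around `v`, so one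
  -- triangle brings in all six.
  rw [h1, not_xor] at k1
  rw [h2, not_xor] at k2
  rw [h3, not_xor] at k3
  rw [h4, not_xor] at k4
  rw [h5, not_xor] at k5
  rw [h6, not_xor] at k6
  clear h1 h2 h3 h4 h5 h6 key
  rcases corner_cases htv with rfl | rfl | rfl | rfl | rfl | rfl <;> simp_all

/-- The contour has no end point. -/
lemma contour_no_leaf {D : Domain} {e : Sym2 Vertex} (he : e ∈ D.contour) {v : Vertex}
    (hv : v ∈ e) : ∃ e' ∈ D.contour, e' ≠ e ∧ v ∈ e' := by
  obtain ⟨u, w, rfl, huw⟩ := exists_posStep_of_mem_edges (contour_subset_edges he)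
  by_contra! hcon
  -- Going once around the six triangles at `v`, membership in `D` cannot change exactly once.
  have key : ∀ e', v ∈ e' → e' ≠ s(u, w) → e' ∉ D.contour := fun e' h1 h2 h3 => hcon e' h3 h2 h1
  obtain ⟨h1, h2, h3, h4, h5, h6⟩ := contour_at (D := D) v
  have k1 := key s(v, v + (1, 0)) (by simp)
  have k2 := key s(v + (0, 1), v) (by simp)
  have k3 := key s(v, v + (-1, 1)) (by simp)
  have k4 := key s(v - (1, 0), v) (by simp)
  have k5 := key s(v, v + (0, -1)) (by simp)
  have k6 := key s(v + (1, -1), v) (by simp)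
  rw [h1, not_xor] at k1
  rw [h2, not_xor] at k2
  rw [h3, not_xor] at k3
  rw [h4, not_xor] at k4
  rw [h5, not_xor] at k5
  rw [h6, not_xor] at k6
  clear hcon key
  obtain ⟨x, y⟩ := v
  rcases edge_at_cases huw hv with h | h | h | h | h | h <;> rw [h] at he k1 k2 k3 k4 k5 k6 <;>
    simp [Prod.ext_iff] at k1 k2 k3 k4 k5 k6
  · rw [h1, xor_iff_iff_not] at he; simp_all; omega
  · rw [h2, xor_iff_iff_not] at he; simp_all
  · rw [h3, xor_iff_iff_not] at he; simp_all
  · rw [h4, xor_iff_iff_not] at he; simp_all; omega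
  · rw [h5, xor_iff_iff_not] at he; simp_all
  · rw [h6, xor_iff_iff_not] at he; simp_all

/-- A domain is determined by its contour. -/
lemma eq_of_contour_eq {F G : Domain} (h : F.contour = G.contour) : F = G := by
  classical
  by_contra hne
  -- The symmetric difference has no contour, so it is closed under passing to adjacent triangles.
  -- If nonempty, it contains an infinite row.
  have hS : ∀ u v, PosStep u v → (upper u v ∈ symmDiff F G ↔ lower u v ∈ symmDiff F G) := by
    intro u v huv
    have := mem_contour_iff (D := F) huv
    rw [h, mem_contour_iff huv] at this
    simp only [Finset.mem_symmDiff, Xor] at this ⊢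
    tauto
  obtain ⟨t, ht⟩ : (symmDiff F G).Nonempty := by
    rw [Finset.nonempty_iff_ne_empty]
    intro h0
    exact hne (symmDiff_eq_bot.1 h0)
  have hb : ∀ p : Vertex, (p, true) ∈ symmDiff F G ↔ (p, false) ∈ symmDiff F G := by
    intro p
    have := hS (p + (1, 0)) (p + (0, 1)) (by right; left; simp [add_assoc])
    obtain ⟨x, y⟩ := p
    simpa [upper, lower] using this
  have hc : ∀ p : Vertex, (p, false) ∈ symmDiff F G → (p + (1, 0), true) ∈ symmDiff F G := by
    intro p
    have := hS (p + (1, 1)) (p + (1, 0)) (by right; right; simp [add_assoc])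
    obtain ⟨x, y⟩ := p
    simp [upper, lower] at this ⊢
    tauto
  obtain ⟨⟨p, q⟩, hpq⟩ : ∃ p : Vertex, (p, true) ∈ symmDiff F G := by
    obtain ⟨p, b⟩ := t
    cases b
    exacts [⟨p, (hb p).2 ht⟩, ⟨p, ht⟩]
  have hn : ∀ n : ℕ, (((p + n, q) : Vertex), true) ∈ symmDiff F G := by
    intro n
    induction n with
    | zero => simpa using hpq
    | succ n ih =>
      have := hc _ ((hb _).1 ih)
      simpa [add_assoc] using this
  refine Set.infinite_of_injective_forall_mem (f := fun n : ℕ => (((p + n, q) : Vertex), true))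
    ?_ hn (symmDiff F G).finite_toSet
  intro a b hab
  simpa using hab

lemma contour_nonempty {F : Domain} (h : F.Nonempty) : F.contour.Nonempty := by
  rw [Set.nonempty_iff_ne_empty]
  intro h0
  have : (∅ : Domain).contour = ∅ := by
    ext e; simp [Domain.contour]
  exact h.ne_empty (eq_of_contour_eq (h0.trans this.symm))

end Geometry

/-! ### Leafless edge sets inside paths and cycles. -/

section Cycles

variable {V : Type*} {G : SimpleGraph V}

/-- The start of the path meets only its first edge, which would be a leaf edge of `S`. Peel it off
and repeat. -/
lemma path_edges_disjoint_of_no_leaf {S : Set (Sym2 V)}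
    (hS : ∀ e ∈ S, ∀ v ∈ e, ∃ e' ∈ S, e' ≠ e ∧ v ∈ e') {x y : V} (p : G.Walk x y)
    (hp : p.IsPath) (hsub : ∀ e ∈ S, e ∈ p.edges) : S = ∅ := by
  induction p with
  | nil => exact Set.eq_empty_of_forall_notMem fun e he => by simpa using hsub e he
  | @cons u v w h q ih =>
    rw [SimpleGraph.Walk.cons_isPath_iff] at hp
    refine ih hp.1 fun e he => ?_
    have := hsub e he
    rw [SimpleGraph.Walk.edges_cons, List.mem_cons] at this
    refine this.resolve_left ?_
    rintro rfl
    obtain ⟨e', he', hne, hu⟩ := hS _ he u (by simp)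
    have := hsub e' he'
    rw [SimpleGraph.Walk.edges_cons, List.mem_cons] at this
    exact hp.2 (SimpleGraph.Walk.mem_support_of_mem_edges (this.resolve_left hne) hu)

/-- An edge `e₀` of `S` arriving at the start must be continued in `S`, and only the first edge of
the path is available; it becomes the next `e₀`. The end `x` is exempted because, when the path
comes from a cycle, the initial `e₀` also touches it. -/
lemma path_edges_subset_of_no_leaf {S : Set (Sym2 V)}
    (hS : ∀ e ∈ S, ∀ v ∈ e, ∃ e' ∈ S, e' ≠ e ∧ v ∈ e') {y x : V} (p : G.Walk y x)
    (hp : p.IsPath) (e₀ : Sym2 V) (he₀ : e₀ ∈ S) (hy : y ∈ e₀)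
    (h₀ : ∀ v ∈ e₀, v ∈ p.support → v = y ∨ v = x)
    (hsub : ∀ e ∈ S, ∀ v ∈ e, v ∈ p.support → v ≠ x → e = e₀ ∨ e ∈ p.edges) :
    ∀ e ∈ p.edges, e ∈ S := by
  induction p generalizing e₀ with
  | nil => simp
  | @cons u v w h q ih =>
    rw [SimpleGraph.Walk.cons_isPath_iff] at hp
    have huw : u ≠ w := fun huw => hp.2 (huw ▸ q.end_mem_support)
    have huv : s(u, v) ∈ S := by
      obtain ⟨e', he', hne, hu⟩ := hS _ he₀ u hy
      have := (hsub e' he' u hu (by simp) huw).resolve_left hne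
      rw [SimpleGraph.Walk.edges_cons, List.mem_cons] at this
      rcases this with rfl | h1
      · exact he'
      · exact absurd (SimpleGraph.Walk.mem_support_of_mem_edges h1 hu) hp.2
    intro e he
    rw [SimpleGraph.Walk.edges_cons, List.mem_cons] at he
    rcases he with rfl | he
    · exact huv
    refine ih hp.1 s(u, v) huv (by simp) ?_ ?_ e he
    · intro a ha has
      rw [Sym2.mem_iff] at ha
      rcases ha with rfl | rfl
      · exact absurd has hp.2
      · exact Or.inl rfl
    · intro e he a ha has hne
      rcases hsub e he a ha (by simp [has]) hne with rfl | h1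
      · rcases h₀ a ha (by simp [has]) with rfl | rfl
        · exact absurd has hp.2
        · exact absurd rfl hne
      · rwa [SimpleGraph.Walk.edges_cons, List.mem_cons] at h1

/-- A set of edges of a cycle without end points is empty or contains all edges of the cycle. -/
lemma cycle_edges_subset_of_no_leaf {S : Set (Sym2 V)}
    (hS : ∀ e ∈ S, ∀ v ∈ e, ∃ e' ∈ S, e' ≠ e ∧ v ∈ e') (hne : S.Nonempty) {x : V}
    (C : G.Walk x x) (hC : C.IsCycle) (hsub : ∀ e ∈ S, e ∈ C.edges) : ∀ e ∈ C.edges, e ∈ S := by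
  cases C with
  | nil => simp
  | @cons u v w h p =>
    rw [SimpleGraph.Walk.cons_isCycle_iff] at hC
    simp only [SimpleGraph.Walk.edges_cons, List.mem_cons] at hsub ⊢
    -- If the first edge is in `S`, it propagates along the rest of the cycle; otherwise `S` lies in
    -- a path and is empty.
    by_cases h0 : s(x, v) ∈ S
    · rintro e (rfl | he)
      · exact h0
      refine path_edges_subset_of_no_leaf hS p hC.1 s(x, v) h0 (by simp) ?_ ?_ e he
      · intro a ha _
        rw [Sym2.mem_iff] at ha
        tauto
      · intro e he a _ _ _
        exact hsub e he
    · refine absurd (path_edges_disjoint_of_no_leaf hS p hC.1 fun e he => ?_) hne.ne_empty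
      refine (hsub e he).resolve_left ?_
      rintro rfl
      exact h0 he

end Cycles

/-- The contour of `F` is nonempty and leafless, so it exhausts the cycle, and contours determine
domains. -/
lemma eq_of_contour_subset {F G : Domain} (hF : F.Nonempty) (h : F.contour ⊆ G.contour)
    {v : Vertex} {C : grid.Walk v v} (hC : C.IsCycle) (hG : IsDelimitedBy G C) : F = G := by
  refine eq_of_contour_eq (Set.Subset.antisymm h ?_)
  rw [IsDelimitedBy] at hG
  rw [hG] at h ⊢
  exact cycle_edges_subset_of_no_leaf (fun e he v hv => contour_no_leaf he hv)
    (contour_nonempty hF) C hC h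

/-- The contour of a connected component is part of the contour of `F`, so the component is all of
`F`. -/
lemma isConnected_of_isDelimitedBy {F : Domain} (hF : F.Nonempty)
    {v : Vertex} {C : grid.Walk v v} (hC : C.IsCycle) (hG : IsDelimitedBy F C) :
    F.IsConnected := by
  classical
  rw [Domain.IsConnected, SimpleGraph.connected_iff]
  refine ⟨?_, hF.to_subtype⟩
  rintro ⟨t, ht⟩ ⟨t', ht'⟩
  set K := Triangle.adjacency.induce (F : Set Triangle)
  set A : Domain := F.filter fun s => ∃ hs : s ∈ (F : Set Triangle), K.Reachable ⟨t, ht⟩ ⟨s, hs⟩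
  have hstep : ∀ s ∈ A, ∀ s' ∈ F, Triangle.adjacency.Adj s s' → s' ∈ A := by
    intro s hs s' hs' hadj
    obtain ⟨hsF, hs1, hr⟩ := Finset.mem_filter.1 hs
    refine Finset.mem_filter.2 ⟨hs', hs', hr.trans (SimpleGraph.Adj.reachable ?_)⟩
    exact hadj
  have hAF : A ⊆ F := Finset.filter_subset _ _
  have hsub : A.contour ⊆ F.contour := by
    intro e he
    obtain ⟨u, w, rfl, huw⟩ := exists_posStep_of_mem_edges (contour_subset_edges he)
    rw [mem_contour_iff huw] at he ⊢
    have hadj : Triangle.adjacency.Adj (upper u w) (lower u w) :=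
      ⟨upper_ne_lower _ _ _ _, Or.inl ⟨s(u, w), (mem_sides_iff huw _).2 (Or.inl rfl),
        (mem_sides_iff huw _).2 (Or.inr rfl)⟩⟩
    rcases he with ⟨h1, h2⟩ | ⟨h1, h2⟩
    · exact Or.inl ⟨hAF h1, fun h3 => h2 (hstep _ h1 _ h3 hadj)⟩
    · exact Or.inr ⟨hAF h1, fun h3 => h2 (hstep _ h1 _ h3 hadj.symm)⟩
  have htA : t ∈ A := Finset.mem_filter.2 ⟨ht, ht, SimpleGraph.Reachable.refl _⟩
  have := eq_of_contour_subset ⟨t, htA⟩ hsub hC hG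
  rw [Finset.mem_coe, ← this] at ht'
  exact (Finset.mem_filter.1 ht').2.2

/-! ### Height functions, their normalization, and solid vertices. -/

section Tilings

lemma PosStep.asymm {u v : Vertex} (h : PosStep u v) : ¬ PosStep v u := by
  intro h'
  have := h.cases
  have := h'.cases
  omega

lemma exists_third_corner {u v : Vertex} (huv : PosStep u v) {t : Triangle}
    (ht : s(u, v) ∈ t.sides) :
    ∃ w, PosStep v w ∧ PosStep w u ∧ s(v, w) ∈ t.sides ∧ s(w, u) ∈ t.sides := by
  obtain ⟨u', v', w, he, h1, h2, h3, h4, h5⟩ := exists_posStep_of_mem_sides ht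
  rcases Sym2.eq_iff.1 he with ⟨rfl, rfl⟩ | ⟨rfl, rfl⟩
  · exact ⟨w, h2, h3, h4, h5⟩
  · exact absurd h1 huv.asymm

/-- The lozenge cut by the grid edge `u v`. -/
def loz (u v : Vertex) : Domain := {upper u v, lower u v}

lemma mem_loz_iff {u v : Vertex} (h : PosStep u v) (t : Triangle) :
    t ∈ loz u v ↔ s(u, v) ∈ t.sides := by
  rw [mem_sides_iff h, loz, Finset.mem_insert, Finset.mem_singleton]

lemma isLozenge_loz {u v : Vertex} (h : PosStep u v) : IsLozenge (loz u v) :=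
  ⟨upper u v, lower u v, ⟨upper_ne_lower _ _ _ _, Or.inl ⟨s(u, v),
    (mem_sides_iff h _).2 (Or.inl rfl), (mem_sides_iff h _).2 (Or.inr rfl)⟩⟩, rfl⟩

lemma IsLozenge.eq_loz {l : Domain} (hl : IsLozenge l) {u v : Vertex} (h : PosStep u v)
    (hs : ∀ t ∈ l, s(u, v) ∈ t.sides) : l = loz u v := by
  obtain ⟨t, t', hadj, rfl⟩ := hl
  have h1 := (mem_sides_iff h _).1 (hs t (by simp))
  have h2 := (mem_sides_iff h _).1 (hs t' (by simp))
  have hne := hadj.ne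
  rcases h1 with rfl | rfl <;> rcases h2 with rfl | rfl
  · exact absurd rfl hne
  · rfl
  · exact Finset.pair_comm _ _
  · exact absurd rfl hne

lemma IsLozenge.exists_loz {l : Domain} (hl : IsLozenge l) :
    ∃ u v, PosStep u v ∧ l = loz u v := by
  obtain ⟨t, t', hadj, rfl⟩ := id hl
  obtain ⟨-, ⟨e, h1, h2⟩ | ⟨e, h2, h1⟩⟩ := hadj
  all_goals
    obtain ⟨u, v, w, rfl, huv, -⟩ := exists_posStep_of_mem_sides h1
    exact ⟨u, v, huv, hl.eq_loz huv (by simp [h1, h2])⟩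

lemma IsTiling.cutsTile_iff {D : Domain} {T : Finset Domain} (hT : IsTiling D T) {u v : Vertex}
    (h : PosStep u v) : CutsTile T s(u, v) ↔ loz u v ∈ T := by
  constructor
  · rintro ⟨l, hl, hs⟩
    rwa [← (hT.1 l hl).eq_loz h hs]
  · intro hl
    exact ⟨_, hl, fun t ht => (mem_loz_iff h t).1 ht⟩

lemma IsTiling.subset {D : Domain} {T : Finset Domain} (hT : IsTiling D T) {l : Domain}
    (hl : l ∈ T) : l ⊆ D := by
  rw [← hT.2.2]
  exact Finset.subset_biUnion_of_mem id hl

lemma IsTiling.exists_mem {D : Domain} {T : Finset Domain} (hT : IsTiling D T) {t : Triangle}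
    (ht : t ∈ D) : ∃ u v, PosStep u v ∧ loz u v ∈ T ∧ t ∈ loz u v := by
  rw [← hT.2.2] at ht
  obtain ⟨l, hl, htl⟩ := Finset.mem_biUnion.1 ht
  obtain ⟨u, v, huv, rfl⟩ := (hT.1 l hl).exists_loz
  exact ⟨u, v, huv, hl, htl⟩

lemma IsTiling.eq_of_mem {D : Domain} {T : Finset Domain} (hT : IsTiling D T) {l l' : Domain}
    (hl : l ∈ T) (hl' : l' ∈ T) {t : Triangle} (ht : t ∈ l) (ht' : t ∈ l') : l = l' := by
  by_contra hne
  exact Finset.disjoint_left.1 (hT.2.1 hl hl' hne) ht ht'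

/-- The sides of a lozenge of a tiling are not cut by the tiling. -/
lemma IsTiling.not_cutsTile {D : Domain} {T : Finset Domain} (hT : IsTiling D T) {u v w : Vertex}
    (huv : PosStep u v) (hvw : PosStep v w) (hwu : PosStep w u) (hl : loz u v ∈ T) {t : Triangle}
    (h1 : s(u, v) ∈ t.sides) (h2 : s(v, w) ∈ t.sides) (h3 : s(w, u) ∈ t.sides) :
    ¬ CutsTile T s(v, w) ∧ ¬ CutsTile T s(w, u) := by
  have ht := (mem_loz_iff huv t).2 h1
  have hU : s(u, v) ∈ (upper u v).sides := (mem_sides_iff huv _).2 (Or.inl rfl)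
  have hL : s(u, v) ∈ (lower u v).sides := (mem_sides_iff huv _).2 (Or.inr rfl)
  have mU : upper u v ∈ loz u v := (mem_loz_iff huv _).2 hU
  have mL : lower u v ∈ loz u v := (mem_loz_iff huv _).2 hL
  constructor
  · rw [hT.cutsTile_iff hvw]
    intro hc
    have he := hT.eq_of_mem hl hc ht ((mem_loz_iff hvw t).2 h2)
    rw [he] at mU mL
    exact upper_ne_lower _ _ _ _ (eq_of_two_common_sides huv hvw hwu hU
      ((mem_loz_iff hvw _).1 mU) hL ((mem_loz_iff hvw _).1 mL))
  · rw [hT.cutsTile_iff hwu]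
    intro hc
    have he := hT.eq_of_mem hl hc ht ((mem_loz_iff hwu t).2 h3)
    rw [he] at mU mL
    exact upper_ne_lower _ _ _ _ (eq_of_two_common_sides hwu huv hvw
      ((mem_loz_iff hwu _).1 mU) hU ((mem_loz_iff hwu _).1 mL) hL)

lemma IsHeight.sides_of_loz {D : Domain} {T : Finset Domain} {h : Vertex → ℤ}
    (hh : IsHeight D T h) (hT : IsTiling D T) {u v w : Vertex}
    (huv : PosStep u v) (hvw : PosStep v w) (hwu : PosStep w u) (hl : loz u v ∈ T) {t : Triangle}
    (h1 : s(u, v) ∈ t.sides) (h2 : s(v, w) ∈ t.sides) (h3 : s(w, u) ∈ t.sides) :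
    h w = h v + 1 ∧ h u = h w + 1 := by
  have htD : t ∈ D := hT.subset hl ((mem_loz_iff huv t).2 h1)
  obtain ⟨n1, n2⟩ := hT.not_cutsTile huv hvw hwu hl h1 h2 h3
  exact ⟨hh v w hvw (Finset.mem_biUnion.2 ⟨t, htD, h2⟩) n1,
    hh w u hwu (Finset.mem_biUnion.2 ⟨t, htD, h3⟩) n2⟩

lemma IsHeight.of_loz {D : Domain} {T : Finset Domain} {h : Vertex → ℤ}
    (hh : IsHeight D T h) (hT : IsTiling D T) {u v : Vertex}
    (huv : PosStep u v) (hl : loz u v ∈ T) : h v = h u - 2 := by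
  have h1 : s(u, v) ∈ (upper u v).sides := (mem_sides_iff huv _).2 (Or.inl rfl)
  obtain ⟨w, hvw, hwu, h2, h3⟩ := exists_third_corner huv h1
  have := hh.sides_of_loz hT huv hvw hwu hl h1 h2 h3
  omega

/-- A cut edge drops by 2 because the other two sides of an adjacent triangle rise by 1 each.
Heights thus tell which edges are cut. -/
lemma IsHeight.step {D : Domain} {T : Finset Domain} {h : Vertex → ℤ}
    (hh : IsHeight D T h) (hT : IsTiling D T) {u v : Vertex}
    (huv : PosStep u v) (he : s(u, v) ∈ D.edges) :
    (h v = h u + 1 ∧ loz u v ∉ T) ∨ (h v = h u - 2 ∧ loz u v ∈ T) := by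
  by_cases hl : loz u v ∈ T
  · exact Or.inr ⟨hh.of_loz hT huv hl, hl⟩
  · exact Or.inl ⟨hh u v huv he (by rwa [hT.cutsTile_iff huv]), hl⟩

/-- Two height functions of a tiling have the same variations. -/
lemma IsHeight.sub_eq_sub {D : Domain} {T : Finset Domain} {h h' : Vertex → ℤ}
    (hh : IsHeight D T h) (hh' : IsHeight D T h') (hT : IsTiling D T) {u v : Vertex}
    (huv : PosStep u v) (he : s(u, v) ∈ D.edges) : h v - h u = h' v - h' u := by
  rcases hh.step hT huv he with ⟨h1, h2⟩ | ⟨h1, h2⟩ <;>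
    rcases hh'.step hT huv he with ⟨h3, h4⟩ | ⟨h3, h4⟩
  · omega
  · exact absurd h4 h2
  · exact absurd h2 h4
  · omega

/-- A function that is constant along the edges of a domain and vanishes on its contour vanishes
on all its vertices. -/
lemma eq_zero_of_contour {D : Domain} {f : Vertex → ℤ}
    (hf : ∀ u v, PosStep u v → s(u, v) ∈ D.edges → f u = f v)
    (h0 : ∀ v ∈ D.contourVertices, f v = 0) : ∀ v ∈ D.vertices, f v = 0 := by
  classical
  by_contra! hcon
  obtain ⟨v, hv, hfv⟩ := hcon
  -- A rightmost vertex with nonzero value is off the contour, so its right neighbour is in `D` and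
  -- has the same value.
  obtain ⟨m, hm, hmax⟩ := Finset.exists_max_image (D.vertices.filter fun v => f v ≠ 0)
    (fun v => v.1) ⟨v, Finset.mem_filter.2 ⟨hv, hfv⟩⟩
  obtain ⟨hmD, hfm⟩ := Finset.mem_filter.1 hm
  have hmc : m ∉ D.contourVertices := fun hc => hfm (h0 m hc)
  have hstep : PosStep m (m + (1, 0)) := Or.inl rfl
  have he : s(m, m + (1, 0)) ∈ D.edges := by
    rw [mem_edges_iff hstep]
    left
    have : upper m (m + (1, 0)) = (m, true) := by
      simp [upper, Prod.le_def]
    rw [this]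
    exact (hexagon_subset hmD hmc).1
  have := hmax (m + (1, 0)) (Finset.mem_filter.2
    ⟨mem_vertices_of_mem_edges he (by simp), by rwa [← hf _ _ hstep he]⟩)
  simp at this

/-- The comparison of two tilings does not depend on the chosen heights: the discrepancy is constant
along edges and zero on the contour. -/
lemma AreNormalizedHeights.sub_eq_sub {D : Domain} {T T' : Finset Domain} {h h' k k' : Vertex → ℤ}
    (hT : IsTiling D T) (hT' : IsTiling D T')
    (hh : AreNormalizedHeights D T T' h h') (hk : AreNormalizedHeights D T T' k k') :
    ∀ v ∈ D.vertices, h' v - h v = k' v - k v := by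
  have := eq_zero_of_contour (D := D) (f := fun v => (h' v - h v) - (k' v - k v)) ?_ ?_
  · intro v hv
    have := this v hv
    omega
  · intro u v huv he
    have h1 := hh.1.sub_eq_sub hk.1 hT huv he
    have h2 := hh.2.1.sub_eq_sub hk.2.1 hT' huv he
    omega
  · intro v hv
    have h1 := hh.2.2 v hv
    have h2 := hk.2.2 v hv
    omega

/-- Take any comparable pair `k`, `k'`. As `h - k` is constant along edges, adding it to `k'` keeps
a height function. -/
lemma exists_normalized {D : Domain} (hD : HasConsistentHeights D) {T T' : Finset Domain}
    (hT : IsTiling D T) (hT' : IsTiling D T') {h : Vertex → ℤ} (hh : IsHeight D T h) :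
    ∃ h', AreNormalizedHeights D T T' h h' := by
  obtain ⟨k, k', hk, hk', hc⟩ := hD T T' hT hT'
  refine ⟨fun v => k' v - k v + h v, hh, ?_, ?_⟩
  · intro u v huv he hcut
    have h1 := hk' u v huv he hcut
    have h2 := hk.sub_eq_sub hh hT huv he
    simp only
    omega
  · intro v hv
    have := hc v hv
    simp only
    omega

lemma TilingLE.le {D : Domain} {T T' : Finset Domain} (hT : IsTiling D T) (hT' : IsTiling D T')
    (hle : TilingLE D T T') {h h' : Vertex → ℤ} (hh : AreNormalizedHeights D T T' h h') :
    ∀ v ∈ D.vertices, h v ≤ h' v := by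
  obtain ⟨k, k', hk, hkle⟩ := hle
  intro v hv
  have := hh.sub_eq_sub hT hT' hk v hv
  have := hkle v hv
  omega

/-- A solid vertex has the same height in all tilings. -/
lemma IsSolid.eq {D : Domain} (hD : HasConsistentHeights D) {x : Vertex} (hx : IsSolid D x)
    {T T' : Finset Domain} (hT : IsTiling D T) (hT' : IsTiling D T') {h h' : Vertex → ℤ}
    (hh : AreNormalizedHeights D T T' h h') : h x = h' x := by
  obtain ⟨hxD, A, B, a, b, hA, hB, hab, heq⟩ := hx
  -- Normalized alike, the extremal heights enclose both `h` and `h'`, and they coincide at `x`.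
  obtain ⟨a', ha'⟩ := exists_normalized hD hT hA.1 hh.1
  obtain ⟨b', hb'⟩ := exists_normalized hD hT hB.1 hh.1
  have hab' : AreNormalizedHeights D A B a' b' :=
    ⟨ha'.2.1, hb'.2.1, fun v hv => (ha'.2.2 v hv).symm.trans (hb'.2.2 v hv)⟩
  have h1 := hab.sub_eq_sub hA.1 hB.1 hab' x hxD
  have h2 := (hA.2 T hT).le hA.1 hT ⟨ha'.2.1, hh.1, fun v hv => (ha'.2.2 v hv).symm⟩ x hxD
  have h3 := (hB.2 T hT).le hT hB.1 hb' x hxD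
  have h4 := (hA.2 T' hT').le hA.1 hT' ⟨ha'.2.1, hh.2.1, fun v hv =>
    (ha'.2.2 v hv).symm.trans (hh.2.2 v hv)⟩ x hxD
  have h5 := (hB.2 T' hT').le hT' hB.1 ⟨hh.2.1, hb'.2.1, fun v hv =>
    (hh.2.2 v hv).symm.trans (hb'.2.2 v hv)⟩ x hxD
  omega

/-- Along an edge with solid ends, the variation of the height is the same in all tilings. -/
lemma IsSolid.sub_eq_sub {D : Domain} (hD : HasConsistentHeights D) {x y : Vertex}
    (hx : IsSolid D x) (hy : IsSolid D y) (hxy : PosStep x y) (he : s(x, y) ∈ D.edges)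
    {T T' : Finset Domain} (hT : IsTiling D T) (hT' : IsTiling D T') {h h' : Vertex → ℤ}
    (hh : IsHeight D T h) (hh' : IsHeight D T' h') : h y - h x = h' y - h' x := by
  obtain ⟨k, hk⟩ := exists_normalized hD hT hT' hh
  have h1 := hx.eq hD hT hT' hk
  have h2 := hy.eq hD hT hT' hk
  have h3 := hk.2.1.sub_eq_sub hh' hT' hxy he
  omega

/-- The restriction of a tiling to a part whose contour it does not cut. -/
lemma IsTiling.restrict {D F : Domain} {T : Finset Domain} (hT : IsTiling D T) (hF : F ⊆ D)
    (hc : ∀ u v, PosStep u v → s(u, v) ∈ F.contour → loz u v ∉ T) : IsTileable F := by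
  classical
  refine ⟨T.filter (· ⊆ F), fun l hl => hT.1 l (Finset.mem_filter.1 hl).1,
    hT.2.1.subset fun l hl => (Finset.mem_filter.1 hl).1, ?_⟩
  ext t
  simp only [Finset.mem_biUnion, Finset.mem_filter, id]
  constructor
  · rintro ⟨l, ⟨-, hl⟩, ht⟩
    exact hl ht
  · intro ht
    obtain ⟨u, v, huv, hl, htl⟩ := hT.exists_mem (hF ht)
    refine ⟨loz u v, ⟨hl, ?_⟩, htl⟩
    -- A tile only partly in `F` would have its diagonal on the contour of `F`.
    by_contra hsub
    refine hc u v huv ?_ hl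
    rw [mem_contour_iff huv]
    simp only [loz, Finset.mem_insert, Finset.mem_singleton, Finset.insert_subset_iff,
      Finset.singleton_subset_iff] at htl hsub
    rcases htl with rfl | rfl
    · exact Or.inl ⟨ht, fun h => hsub ⟨ht, h⟩⟩
    · exact Or.inr ⟨ht, fun h => hsub ⟨h, ht⟩⟩

end Tilings

/-! ### Flips around a vertex, and their absence in extremal tilings. -/

section Flips

lemma IsTiling.exchange {D : Domain} {T A B : Finset Domain} (hT : IsTiling D T) (hA : A ⊆ T)
    (hB : IsTiling (A.biUnion id) B) : IsTiling D (T \ A ∪ B) := by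
  have hdisj : ∀ l ∈ T \ A, ∀ l' ∈ B, Disjoint l l' := by
    intro l hl l' hl'
    rw [Finset.disjoint_left]
    intro t ht ht'
    obtain ⟨m, hm, htm⟩ := Finset.mem_biUnion.1 (hB.subset hl' ht')
    obtain ⟨h1, h2⟩ := Finset.mem_sdiff.1 hl
    rw [hT.eq_of_mem h1 (hA hm) ht htm] at h2
    exact h2 hm
  refine ⟨?_, ?_, ?_⟩
  · intro l hl
    rcases Finset.mem_union.1 hl with h | h
    exacts [hT.1 l (Finset.mem_sdiff.1 h).1, hB.1 l h]
  · intro l hl l' hl' hne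
    rcases Finset.mem_union.1 hl with h | h <;> rcases Finset.mem_union.1 hl' with h' | h'
    · exact hT.2.1 (Finset.mem_sdiff.1 h).1 (Finset.mem_sdiff.1 h').1 hne
    · exact hdisj l h l' h'
    · exact (hdisj l' h' l h).symm
    · exact hB.2.1 h h' hne
  · rw [Finset.union_biUnion, hB.2.2, ← Finset.union_biUnion, Finset.sdiff_union_of_subset hA,
      hT.2.2]

/-- The three lozenges around `v` cut by the edges towards `v`. -/
def inTiles (v : Vertex) : Finset Domain :=
  {loz (v + (-1, 0)) v, loz (v + (1, -1)) v, loz (v + (0, 1)) v}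

/-- The three lozenges around `v` cut by the edges from `v`. -/
def outTiles (v : Vertex) : Finset Domain :=
  {loz v (v + (1, 0)), loz v (v + (-1, 1)), loz v (v + (0, -1))}

lemma mem_inTiles {v : Vertex} {l : Domain} : l ∈ inTiles v ↔ ∃ u, PosStep u v ∧ l = loz u v := by
  simp only [inTiles, Finset.mem_insert, Finset.mem_singleton]
  constructor
  · rintro (rfl | rfl | rfl) <;> refine ⟨_, ?_, rfl⟩ <;> simp [PosStep, add_assoc]
  · rintro ⟨⟨x, y⟩, rfl | rfl | rfl, rfl⟩ <;> simp

lemma mem_outTiles {v : Vertex} {l : Domain} :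
    l ∈ outTiles v ↔ ∃ w, PosStep v w ∧ l = loz v w := by
  simp only [outTiles, Finset.mem_insert, Finset.mem_singleton]
  constructor
  · rintro (rfl | rfl | rfl) <;> refine ⟨_, ?_, rfl⟩ <;> simp [PosStep]
  · rintro ⟨u, rfl | rfl | rfl, rfl⟩ <;> simp

lemma biUnion_inTiles (v : Vertex) : (inTiles v).biUnion id = (outTiles v).biUnion id := by
  obtain ⟨x, y⟩ := v
  ext ⟨⟨p, q⟩, b⟩
  cases b <;> simp [inTiles, outTiles, loz, upper, lower] <;> omega

lemma pairwiseDisjoint_inTiles (v : Vertex) :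
    (inTiles v : Set Domain).PairwiseDisjoint id := by
  intro l hl l' hl' hne
  rw [Finset.mem_coe, mem_inTiles] at hl hl'
  obtain ⟨u, hu, rfl⟩ := hl
  obtain ⟨w, hw, rfl⟩ := hl'
  simp only [Function.onFun, id]
  rw [Finset.disjoint_left]
  intro t h1 h2
  have huw : u ≠ w := by rintro rfl; exact hne rfl
  rw [Ne, Prod.ext_iff] at huw
  have := hu.cases
  have := hw.cases
  simp only [loz, upper, lower, Finset.mem_insert, Finset.mem_singleton] at h1 h2
  rcases h1 with rfl | rfl <;> simp [Prod.ext_iff] at h2 <;> omega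

lemma pairwiseDisjoint_outTiles (v : Vertex) :
    (outTiles v : Set Domain).PairwiseDisjoint id := by
  intro l hl l' hl' hne
  rw [Finset.mem_coe, mem_outTiles] at hl hl'
  obtain ⟨u, hu, rfl⟩ := hl
  obtain ⟨w, hw, rfl⟩ := hl'
  simp only [Function.onFun, id]
  rw [Finset.disjoint_left]
  intro t h1 h2
  have huw : u ≠ w := by rintro rfl; exact hne rfl
  rw [Ne, Prod.ext_iff] at huw
  have := hu.cases
  have := hw.cases
  simp only [loz, upper, lower, Finset.mem_insert, Finset.mem_singleton] at h1 h2
  rcases h1 with rfl | rfl <;> simp [Prod.ext_iff] at h2 <;> omega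

lemma isTiling_outTiles (v : Vertex) : IsTiling ((inTiles v).biUnion id) (outTiles v) := by
  refine ⟨fun l hl => ?_, pairwiseDisjoint_outTiles v, (biUnion_inTiles v).symm⟩
  obtain ⟨w, hw, rfl⟩ := mem_outTiles.1 hl
  exact isLozenge_loz hw

lemma isTiling_inTiles (v : Vertex) : IsTiling ((outTiles v).biUnion id) (inTiles v) := by
  refine ⟨fun l hl => ?_, pairwiseDisjoint_inTiles v, biUnion_inTiles v⟩
  obtain ⟨w, hw, rfl⟩ := mem_inTiles.1 hl
  exact isLozenge_loz hw

lemma loz_injective {u v u' v' : Vertex} (h : PosStep u v) (h' : PosStep u' v')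
    (he : loz u v = loz u' v') : u = u' ∧ v = v' := by
  have h1 : upper u v ∈ loz u' v' := by rw [← he]; simp [loz]
  have h2 : lower u v ∈ loz u' v' := by rw [← he]; simp [loz]
  simp [loz, upper, lower, Prod.ext_iff] at h1 h2
  have := h.cases
  have := h'.cases
  rw [Prod.ext_iff, Prod.ext_iff]
  omega

/-- In a maximal tiling no vertex off the contour can be flipped upwards. -/
lemma IsMaximalTiling.exists_inner {D : Domain} {T : Finset Domain} (hT : IsMaximalTiling D T)
    {h : Vertex → ℤ} (hh : IsHeight D T h) {v : Vertex} (hv : v ∈ D.vertices)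
    (hc : v ∉ D.contourVertices) (hin : ∀ u, PosStep u v → s(u, v) ∈ D.edges) :
    ∃ u, PosStep u v ∧ h v = h u + 1 := by
  classical
  by_contra! hcon
  -- If no edge into `v` rises by 1, all three are cut and the hexagon around `v` can be flipped.
  have hA : inTiles v ⊆ T := by
    intro l hl
    obtain ⟨u, hu, rfl⟩ := mem_inTiles.1 hl
    rcases hh.step hT.1 hu (hin u hu) with ⟨h1, -⟩ | ⟨-, h2⟩
    exacts [absurd h1 (hcon u hu), h2]
  have hT' := hT.1.exchange hA (isTiling_outTiles v)
  -- The flip changes incoming variations from -2 to 1, hence the 3. The contour is untouched, so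
  -- heights remain comparable and maximality is contradicted.
  have hh' : IsHeight D (T \ inTiles v ∪ outTiles v) (Function.update h v (h v + 3)) := by
    intro u w huw he hcut
    rw [hT'.cutsTile_iff huw] at hcut
    by_cases huv : u = v
    · subst huv
      exact absurd (Finset.mem_union_right _ (mem_outTiles.2 ⟨w, huw, rfl⟩)) hcut
    by_cases hwv : w = v
    · subst hwv
      have := hh.of_loz hT.1 huw (hA (mem_inTiles.2 ⟨u, huw, rfl⟩))
      rw [Function.update_self, Function.update_of_ne huv]
      omega
    rw [Function.update_of_ne huv, Function.update_of_ne hwv]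
    refine hh u w huw he fun hcut' => hcut (Finset.mem_union_left _ ?_)
    rw [hT.1.cutsTile_iff huw] at hcut'
    refine Finset.mem_sdiff.2 ⟨hcut', fun hl => ?_⟩
    obtain ⟨u', hu', heq⟩ := mem_inTiles.1 hl
    exact hwv (loz_injective huw hu' heq).2
  have := (hT.2 _ hT').le hT' hT.1 ⟨hh', hh, fun x hx => Function.update_of_ne
    (fun hxv => hc (by rwa [hxv] at hx)) _ _⟩ v hv
  rw [Function.update_self] at this
  omega

/-- In a minimal tiling no vertex off the contour can be flipped downwards. -/
lemma IsMinimalTiling.exists_outer {D : Domain} {T : Finset Domain} (hT : IsMinimalTiling D T)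
    {h : Vertex → ℤ} (hh : IsHeight D T h) {v : Vertex} (hv : v ∈ D.vertices)
    (hc : v ∉ D.contourVertices) (hout : ∀ w, PosStep v w → s(v, w) ∈ D.edges) :
    ∃ w, PosStep v w ∧ h w = h v + 1 := by
  classical
  by_contra! hcon
  have hA : outTiles v ⊆ T := by
    intro l hl
    obtain ⟨u, hu, rfl⟩ := mem_outTiles.1 hl
    rcases hh.step hT.1 hu (hout u hu) with ⟨h1, -⟩ | ⟨-, h2⟩
    exacts [absurd h1 (hcon u hu), h2]
  have hT' := hT.1.exchange hA (isTiling_inTiles v)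
  have hh' : IsHeight D (T \ outTiles v ∪ inTiles v) (Function.update h v (h v - 3)) := by
    intro u w huw he hcut
    rw [hT'.cutsTile_iff huw] at hcut
    by_cases hwv : w = v
    · subst hwv
      exact absurd (Finset.mem_union_right _ (mem_inTiles.2 ⟨u, huw, rfl⟩)) hcut
    by_cases huv : u = v
    · subst huv
      have := hh.of_loz hT.1 huw (hA (mem_outTiles.2 ⟨w, huw, rfl⟩))
      rw [Function.update_self, Function.update_of_ne hwv]
      omega
    rw [Function.update_of_ne huv, Function.update_of_ne hwv]
    refine hh u w huw he fun hcut' => hcut (Finset.mem_union_left _ ?_)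
    rw [hT.1.cutsTile_iff huw] at hcut'
    refine Finset.mem_sdiff.2 ⟨hcut', fun hl => ?_⟩
    obtain ⟨u', hu', heq⟩ := mem_outTiles.1 hl
    exact huv (loz_injective huw hu' heq).1
  have := (hT.2 _ hT').le hT.1 hT' ⟨hh, hh', fun x hx => (Function.update_of_ne
    (fun hxv => hc (by rwa [hxv] at hx)) _ _).symm⟩ v hv
  rw [Function.update_self] at this
  omega

end Flips

/-! ### The graph of solid edges, and the structure of fracture zones. -/

section FractureZones

lemma mem_of_mem_corners {F : Domain} {v : Vertex} (hv : v ∈ F.vertices)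
    (hc : v ∉ F.contourVertices) {t : Triangle} (ht : v ∈ t.corners) : t ∈ F := by
  obtain ⟨h1, h2, h3, h4, h5, h6⟩ := hexagon_subset hv hc
  rcases corner_cases ht with rfl | rfl | rfl | rfl | rfl | rfl <;> assumption

lemma mem_edges_of_interior {F : Domain} {v : Vertex} (hv : v ∈ F.vertices)
    (hc : v ∉ F.contourVertices) {u w : Vertex} (huw : PosStep u w) (h : v ∈ s(u, w)) :
    s(u, w) ∈ F.edges := by
  rw [mem_edges_iff huw]
  exact Or.inl (mem_of_mem_corners hv hc
    (mem_corners_of_mem_sides ((mem_sides_iff huw _).2 (Or.inl rfl)) h))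

lemma notMem_contourVertices_of_subset {D F : Domain} (hFD : F ⊆ D) {v : Vertex}
    (hv : v ∈ F.vertices) (hc : v ∉ F.contourVertices) : v ∉ D.contourVertices := by
  rintro ⟨e, he, hve⟩
  obtain ⟨u, w, rfl, huw⟩ := exists_posStep_of_mem_edges (contour_subset_edges he)
  have h1 := hFD (mem_of_mem_corners hv hc
    (mem_corners_of_mem_sides ((mem_sides_iff huw _).2 (Or.inl rfl)) hve))
  have h2 := hFD (mem_of_mem_corners hv hc
    (mem_corners_of_mem_sides ((mem_sides_iff huw _).2 (Or.inr rfl)) hve))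
  rw [mem_contour_iff huw] at he
  rcases he with ⟨-, h⟩ | ⟨-, h⟩
  exacts [h h2, h h1]

/-- The edges of `F` with solid ends along which the height `h` varies by `1`. -/
def solidGraph (D F : Domain) (h : Vertex → ℤ) : SimpleGraph Vertex where
  Adj a b := grid.Adj a b ∧ s(a, b) ∈ F.edges ∧ IsSolid D a ∧ IsSolid D b ∧ |h b - h a| = 1
  symm := ⟨fun a b ⟨h1, h2, h3, h4, h5⟩ =>
    ⟨h1.symm, by rwa [Sym2.eq_swap], h4, h3, by rwa [abs_sub_comm]⟩⟩
  loopless := ⟨fun a ⟨h1, _⟩ => h1.ne rfl⟩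

lemma solidGraph_le (D F : Domain) (h : Vertex → ℤ) : solidGraph D F h ≤ grid :=
  fun _ _ hab => hab.1

lemma solidGraph_adj_of_posStep {D F : Domain} {h : Vertex → ℤ} {u v : Vertex}
    (huv : PosStep u v) (he : s(u, v) ∈ F.edges) (hu : IsSolid D u) (hv : IsSolid D v)
    (hh : h v = h u + 1) : (solidGraph D F h).Adj u v :=
  ⟨huv.adj, he, hu, hv, by simp [hh]⟩

/-- A cycle of the graph of solid edges is a fracture line. -/
lemma isFractureLine_of_isCycle {D F : Domain} (hFD : F ⊆ D) {T : Finset Domain}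
    (hT : IsTiling D T) {h : Vertex → ℤ} (hh : IsHeight D T h) {v : Vertex}
    (C : (solidGraph D F h).Walk v v) (hC : C.IsCycle) :
    IsFractureLine D (C.mapLe (solidGraph_le D F h)) ∧
      LiesIn (C.mapLe (solidGraph_le D F h)) F := by
  have hedge : ∀ e ∈ C.edges, e ∈ F.edges := by
    intro e he
    induction e with
    | _ a b => exact (C.adj_of_mem_edges he).2.1
  have hsupp : ∀ x ∈ C.support, ∃ y, (solidGraph D F h).Adj x y := by
    intro x hx
    obtain ⟨e, he, hxe⟩ := (SimpleGraph.Walk.mem_support_iff_exists_mem_edges_of_not_nil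
      hC.not_nil).1 hx
    induction e with
    | _ a b =>
      have := C.adj_of_mem_edges he
      rcases Sym2.mem_iff.1 hxe with rfl | rfl
      exacts [⟨_, this⟩, ⟨_, this.symm⟩]
  have hv : v ∈ F.vertices := by
    obtain ⟨y, hy⟩ := hsupp v C.start_mem_support
    exact mem_vertices_of_mem_edges hy.2.1 (by simp)
  have hlies : LiesIn (C.mapLe (solidGraph_le D F h)) F := ⟨hv, by simpa using hedge⟩
  refine ⟨⟨⟨T, hT, ⟨vertices_mono hFD hv, fun e he => edges_mono hFD (hlies.2 e he)⟩,
    Or.inr (hC.mapLe _), h, hh, ?_⟩, ?_⟩, hlies⟩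
  · intro d hd
    have : s(d.fst, d.snd) ∈ C.edges := by
      rw [← SimpleGraph.Walk.edges_mapLe_eq_edges (solidGraph_le D F h) C]
      exact List.mem_map.2 ⟨d, hd, rfl⟩
    exact (C.adj_of_mem_edges this).2.2.2.2
  · intro x hx
    rw [SimpleGraph.Walk.support_mapLe_eq_support] at hx
    obtain ⟨y, hy⟩ := hsupp x hx
    exact hy.2.2.1

/-- If all fracture lines in `F` have the same edges as `L`, then an edge of the graph of solid
edges that is not a bridge is an edge of `L`. -/
lemma mem_edges_of_reachable {D F : Domain} (hFD : F ⊆ D) {T : Finset Domain}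
    (hT : IsTiling D T) {h : Vertex → ℤ} (hh : IsHeight D T h) {x : Vertex} {L : grid.Walk x x}
    (hL : ∀ (w : Vertex) (C : grid.Walk w w), IsFractureLine D C → ¬ C.Nil → LiesIn C F →
      ∀ e, e ∈ C.edges ↔ e ∈ L.edges)
    {u v : Vertex} (huv : (solidGraph D F h).Adj u v)
    (hr : ((solidGraph D F h).deleteEdges {s(u, v)}).Reachable u v) : s(u, v) ∈ L.edges := by
  obtain ⟨w, C, hC, he⟩ :=
    SimpleGraph.adj_and_reachable_delete_edges_iff_exists_cycle.1 ⟨huv, hr⟩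
  obtain ⟨h1, h2⟩ := isFractureLine_of_isCycle hFD hT hh C hC
  refine (hL _ _ h1 (hC.mapLe (solidGraph_le D F h)).not_nil h2 _).1 ?_
  rwa [SimpleGraph.Walk.edges_mapLe_eq_edges]

/-- Descend through solid vertices until the contour is met. The path stays strictly below `v`, so
it never uses the deleted edge. -/
lemma exists_reachable_contour_below {D F : Domain} {h : Vertex → ℤ} {u v : Vertex}
    (hstep : ∀ x ∈ F.vertices, x ∉ F.contourVertices → IsSolid D x →
      ∃ y, (solidGraph D F h).Adj x y ∧ h y < h x)
    {x : Vertex} (hx : x ∈ F.vertices) (hs : IsSolid D x) (hxv : h x < h v) :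
    ∃ y ∈ F.contourVertices, ((solidGraph D F h).deleteEdges {s(u, v)}).Reachable x y := by
  classical
  by_contra hcon
  obtain ⟨m, hm, hmin⟩ := Finset.exists_min_image (F.vertices.filter fun x => IsSolid D x ∧
    h x < h v ∧ ¬ ∃ y ∈ F.contourVertices,
      ((solidGraph D F h).deleteEdges {s(u, v)}).Reachable x y) h
    ⟨x, Finset.mem_filter.2 ⟨hx, hs, hxv, hcon⟩⟩
  obtain ⟨hmF, hms, hmv, hmr⟩ := Finset.mem_filter.1 hm
  have hmc : m ∉ F.contourVertices := fun hc => hmr ⟨m, hc, SimpleGraph.Reachable.refl _⟩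
  obtain ⟨y, hadj, hlt⟩ := hstep m hmF hmc hms
  refine absurd (hmin y (Finset.mem_filter.2
    ⟨mem_vertices_of_mem_edges hadj.2.1 (by simp), hadj.2.2.2.1, hlt.trans hmv, ?_⟩)) (by omega)
  rintro ⟨z, hz, hr⟩
  refine hmr ⟨z, hz, SimpleGraph.Reachable.trans (SimpleGraph.Adj.reachable ?_) hr⟩
  rw [SimpleGraph.deleteEdges_adj]
  refine ⟨hadj, fun he => ?_⟩
  rcases Sym2.eq_iff.1 (Set.mem_singleton_iff.1 he) with ⟨-, rfl⟩ | ⟨rfl, -⟩ <;> omega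

lemma solidGraph_neg (D F : Domain) (h : Vertex → ℤ) :
    solidGraph D F (fun v => - h v) = solidGraph D F h := by
  ext a b
  have : - h b - - h a = - (h b - h a) := by ring
  simp only [solidGraph, this, abs_neg]

/-- An edge of the graph of solid edges of which some end is off the contour is not a bridge. -/
lemma reachable_of_interior {D F : Domain} {h : Vertex → ℤ}
    (hdown : ∀ x ∈ F.vertices, x ∉ F.contourVertices → IsSolid D x →
      ∃ y, (solidGraph D F h).Adj x y ∧ h y < h x)
    (hup : ∀ x ∈ F.vertices, x ∉ F.contourVertices → IsSolid D x →
      ∃ y, (solidGraph D F h).Adj x y ∧ h x < h y)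
    {u v : Vertex} (huv : (solidGraph D F h).Adj u v) (hlt : h u < h v)
    (hcon : ∀ y ∈ F.contourVertices, ∀ z ∈ F.contourVertices,
      ((solidGraph D F h).deleteEdges {s(u, v)}).Reachable y z) :
    ((solidGraph D F h).deleteEdges {s(u, v)}).Reachable u v := by
  obtain ⟨y, hy, h1⟩ := exists_reachable_contour_below (u := u) hdown
    (mem_vertices_of_mem_edges huv.2.1 (by simp)) huv.2.2.1 hlt
  -- Negating heights turns the ascent from `v` into a descent.
  obtain ⟨z, hz, h2⟩ := exists_reachable_contour_below (D := D) (F := F) (h := fun v => - h v)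
    (u := v) (v := u) (by simpa [solidGraph_neg] using hup)
    (mem_vertices_of_mem_edges huv.2.1 (by simp)) huv.2.2.2.1 (by simpa using hlt)
  rw [solidGraph_neg, Sym2.eq_swap] at h2
  exact h1.trans ((hcon y hy z hz).trans h2.symm)

lemma isCycle_of_isDelimitedBy {F : Domain} (hF : F.Nonempty) {v : Vertex} {C : grid.Walk v v}
    (hC : C.Nil ∨ C.IsCycle) (hFC : IsDelimitedBy F C) : C.IsCycle := by
  refine hC.resolve_left fun hnil => ?_
  obtain ⟨e, he⟩ := contour_nonempty hF
  rw [IsDelimitedBy] at hFC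
  rw [hFC, Set.mem_ofPred_eq, SimpleGraph.Walk.edges_eq_nil.2 hnil] at he
  simp at he

/-- The sides of a lozenge whose diagonal joins two solid vertices and is cut by a tiling. -/
lemma solidGraph_adj_of_loz {D F : Domain} (hD : HasConsistentHeights D) (hFD : F ⊆ D)
    {A B : Finset Domain} {a b : Vertex → ℤ} (hA : IsMinimalTiling D A)
    (hB : IsMaximalTiling D B) (hab : AreNormalizedHeights D A B a b)
    {u v w : Vertex} (huv : PosStep u v) (hvw : PosStep v w) (hwu : PosStep w u)
    (hu : IsSolid D u) (hv : IsSolid D v) (hl : loz u v ∈ B) {t : Triangle} (ht : t ∈ F)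
    (h1 : s(u, v) ∈ t.sides) (h2 : s(v, w) ∈ t.sides) (h3 : s(w, u) ∈ t.sides) :
    (solidGraph D F b).Adj v w ∧ (solidGraph D F b).Adj w u := by
  have he : s(u, v) ∈ D.edges := Finset.mem_biUnion.2 ⟨t, hFD ht, h1⟩
  have e2 : s(v, w) ∈ F.edges := Finset.mem_biUnion.2 ⟨t, ht, h2⟩
  have e3 : s(w, u) ∈ F.edges := Finset.mem_biUnion.2 ⟨t, ht, h3⟩
  have hb := hab.2.1.sides_of_loz hB.1 huv hvw hwu hl h1 h2 h3
  -- Solid ends force the same drop of 2 in `A`. In both tilings `w` is then one below `u`, hence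
  -- solid.
  have hlA : loz u v ∈ A := by
    have := hu.sub_eq_sub hD hv huv he hA.1 hB.1 hab.1 hab.2.1
    rcases hab.1.step hA.1 huv he with ⟨h4, -⟩ | ⟨-, h4⟩
    · omega
    · exact h4
  have ha := hab.1.sides_of_loz hA.1 huv hvw hwu hlA h1 h2 h3
  have huab := hu.eq hD hA.1 hB.1 hab
  have hw : IsSolid D w := ⟨mem_vertices_of_mem_edges (edges_mono hFD e2) (by simp),
    A, B, a, b, hA, hB, hab, by omega⟩
  exact ⟨solidGraph_adj_of_posStep hvw e2 hv hw hb.1, solidGraph_adj_of_posStep hwu e3 hw hu hb.2⟩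

/-- Each side of a solid lozenge boundary takes the role of `p q` in turn, which shows that none is
a bridge. -/
lemma reachable_deleteEdges_of_square {V : Type*} {H : SimpleGraph V} {p q r s : V}
    (hqr : H.Adj q r) (hrs : H.Adj r s) (hsp : H.Adj s p) (hpr : p ≠ r) (hqs : q ≠ s) :
    (H.deleteEdges {s(p, q)}).Reachable p q := by
  have h1 : (H.deleteEdges {s(p, q)}).Adj q r := by
    rw [SimpleGraph.deleteEdges_adj]
    refine ⟨hqr, ?_⟩
    simp only [Set.mem_singleton_iff, Sym2.eq_iff]
    rintro (⟨-, h⟩ | ⟨-, h⟩)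
    exacts [hqr.ne h.symm, hpr h.symm]
  have h2 : (H.deleteEdges {s(p, q)}).Adj r s := by
    rw [SimpleGraph.deleteEdges_adj]
    refine ⟨hrs, ?_⟩
    simp only [Set.mem_singleton_iff, Sym2.eq_iff]
    rintro (⟨h, -⟩ | ⟨h, -⟩)
    exacts [hpr h.symm, hqr.ne h.symm]
  have h3 : (H.deleteEdges {s(p, q)}).Adj s p := by
    rw [SimpleGraph.deleteEdges_adj]
    refine ⟨hsp, ?_⟩
    simp only [Set.mem_singleton_iff, Sym2.eq_iff]
    rintro (⟨h, -⟩ | ⟨h, -⟩)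
    exacts [hsp.ne h, hqs h.symm]
  exact (h1.reachable.trans (h2.reachable.trans h3.reachable)).symm

/-- A fracture zone is pre-fertile or a lozenge. -/
lemma IsFractureZone.isPreFertile_or_isLozenge {D : Domain} (hD : HasConsistentHeights D)
    {F : Domain} (hF : IsFractureZone D F) : IsPreFertile D F ∨ IsLozenge F := by
  classical
  obtain ⟨hsub, hne, x, L, ⟨⟨T, hT, ⟨hLD, hLc, h, hh, hLh⟩⟩, hsolid⟩, hdel, huniq⟩ := hF
  have hFD := hsub.1
  have hLcyc := isCycle_of_isDelimitedBy hne hLc hdel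
  have hcontour : ∀ e, e ∈ F.contour ↔ e ∈ L.edges := fun e => by
    rw [IsDelimitedBy] at hdel
    rw [hdel, Set.mem_ofPred_eq]
  have hcsupp : ∀ v ∈ F.contourVertices, v ∈ L.support := by
    rintro v ⟨e, he, hv⟩
    exact SimpleGraph.Walk.mem_support_of_mem_edges ((hcontour e).1 he) hv
  have hcsolid : ∀ v ∈ F.contourVertices, IsSolid D v := fun v hv => hsolid v (hcsupp v hv)
  obtain ⟨-, A, B, a, b, hA, hB, hab, -⟩ := hsolid x L.start_mem_support
  have hle : ∀ v ∈ D.vertices, a v ≤ b v := (hA.2 B hB.1).le hA.1 hB.1 hab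
  have hmk : ∀ v ∈ D.vertices, a v = b v → IsSolid D v := fun v hv hv' =>
    ⟨hv, A, B, a, b, hA, hB, hab, hv'⟩
  -- Validity for `T` excludes a drop of 2; solidity of the ends carries the rise over to the
  -- maximal tiling.
  have hcut : ∀ u v, PosStep u v → s(u, v) ∈ L.edges → h v = h u + 1 ∧ b v = b u + 1 := by
    intro u v huv he
    have heD := hLD.2 _ he
    have h1 : |h v - h u| = 1 := by
      obtain ⟨d, hd, hde⟩ := List.mem_map.1 he
      have := hLh d hd
      rcases Sym2.eq_iff.1 (show s(d.fst, d.snd) = s(u, v) from hde) with ⟨h1, h2⟩ | ⟨h1, h2⟩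
      · rwa [h1, h2] at this
      · rwa [h1, h2, abs_sub_comm] at this
    have h2 := (hsolid u (SimpleGraph.Walk.fst_mem_support_of_mem_edges L he)).sub_eq_sub hD
      (hsolid v (SimpleGraph.Walk.snd_mem_support_of_mem_edges L he)) huv heD hT hB.1 hh hab.2.1
    rcases hh.step hT huv heD with ⟨h3, -⟩ | ⟨h3, -⟩
    · omega
    · rw [h3] at h1
      norm_num at h1
  have htile : IsTileable F := by
    refine hT.restrict hFD fun u v huv he hl => ?_
    have := (hcut u v huv ((hcontour _).1 he)).1
    have := hh.of_loz hT huv hl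
    omega
  have hLadj : ∀ e ∈ L.edges, e ∈ (solidGraph D F b).edgeSet := by
    intro e he
    have heF := contour_subset_edges ((hcontour e).2 he)
    obtain ⟨u, v, rfl, huv⟩ := exists_posStep_of_mem_edges heF
    exact solidGraph_adj_of_posStep huv heF
      (hsolid u (SimpleGraph.Walk.fst_mem_support_of_mem_edges L he))
      (hsolid v (SimpleGraph.Walk.snd_mem_support_of_mem_edges L he)) (hcut u v huv he).2
  have hLreach : ∀ e ∉ L.edges, ∀ y ∈ F.contourVertices, ∀ z ∈ F.contourVertices,
      ((solidGraph D F b).deleteEdges {e}).Reachable y z := by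
    intro e he y hy z hz
    have htr : ∀ e' ∈ L.edges, e' ∈ ((solidGraph D F b).deleteEdges {e}).edgeSet := by
      intro e' he'
      rw [SimpleGraph.edgeSet_deleteEdges]
      refine ⟨hLadj e' he', ?_⟩
      rintro rfl
      exact he he'
    have key : ∀ y ∈ F.contourVertices,
        ((solidGraph D F b).deleteEdges {e}).Reachable x y := by
      intro y hy
      exact ((L.transfer _ htr).takeUntil y (by simpa using hcsupp y hy)).reachable
    exact (key y hy).symm.trans (key z hz)
  have hnb : ∀ {u v}, (solidGraph D F b).Adj u v →
      ((solidGraph D F b).deleteEdges {s(u, v)}).Reachable u v → s(u, v) ∈ L.edges :=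
    fun h1 h2 => mem_edges_of_reachable hFD hB.1 hab.2.1 huniq h1 h2
  have hdown : ∀ x ∈ F.vertices, x ∉ F.contourVertices → IsSolid D x →
      ∃ y, (solidGraph D F b).Adj x y ∧ b y < b x := by
    intro v hv hvc hvs
    have hvD := vertices_mono hFD hv
    obtain ⟨u, huv, hbu⟩ := hB.exists_inner hab.2.1 hvD
      (notMem_contourVertices_of_subset hFD hv hvc) fun u huv =>
        edges_mono hFD (mem_edges_of_interior hv hvc huv (by simp))
    have he := mem_edges_of_interior hv hvc huv (by simp)
    have huD := mem_vertices_of_mem_edges (edges_mono hFD he) (Sym2.mem_mk_left u v)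
    have hus : IsSolid D u := by
      refine hmk u huD ?_
      have h1 := hle u huD
      -- Here `a u ≤ b u = b v - 1 = a v - 1 ≤ a u`, so `u` is solid too.
      have h2 := hvs.eq hD hA.1 hB.1 hab
      rcases hab.1.step hA.1 huv (edges_mono hFD he) with ⟨h3, -⟩ | ⟨h3, -⟩ <;> omega
    exact ⟨u, (solidGraph_adj_of_posStep huv he hus hvs hbu).symm, by omega⟩
  have hup : ∀ x ∈ F.vertices, x ∉ F.contourVertices → IsSolid D x →
      ∃ y, (solidGraph D F b).Adj x y ∧ b x < b y := by
    intro v hv hvc hvs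
    have hvD := vertices_mono hFD hv
    obtain ⟨w, hvw, haw⟩ := hA.exists_outer hab.1 hvD
      (notMem_contourVertices_of_subset hFD hv hvc) fun w hvw =>
        edges_mono hFD (mem_edges_of_interior hv hvc hvw (by simp))
    have he := mem_edges_of_interior hv hvc hvw (by simp)
    have hwD := mem_vertices_of_mem_edges (edges_mono hFD he) (Sym2.mem_mk_right v w)
    have h1 := hle w hwD
    have h2 := hvs.eq hD hA.1 hB.1 hab
    have h4 : b w = b v + 1 := by
      rcases hab.2.1.step hB.1 hvw (edges_mono hFD he) with ⟨h3, -⟩ | ⟨h3, -⟩ <;> omega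
    exact ⟨w, solidGraph_adj_of_posStep hvw he hvs (hmk w hwD (by omega)) h4, by omega⟩
  have hinterior : ∀ v ∈ F.vertices, v ∉ F.contourVertices → ¬ IsSolid D v := by
    intro v hv hvc hvs
    obtain ⟨u, hadj, hlt⟩ := hdown v hv hvc hvs
    have hnot : s(u, v) ∉ L.edges := fun he => hvc ⟨_, (hcontour _).2 he, by simp⟩
    exact hnot (hnb hadj.symm (reachable_of_interior hdown hup hadj.symm hlt (hLreach _ hnot)))
  by_cases hchord : ∃ u v, PosStep u v ∧ u ∈ F.contourVertices ∧ v ∈ F.contourVertices ∧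
      s(u, v) ∈ F.edges ∧ s(u, v) ∉ F.contour
  · right
    obtain ⟨u, v, huv, hu, hv, he, hnc⟩ := hchord
    have hnL : s(u, v) ∉ L.edges := fun h => hnc ((hcontour _).2 h)
    -- An uncut chord would be a solid edge outside `L` whose ends are joined along `L`.
    rcases hab.2.1.step hB.1 huv (edges_mono hFD he) with ⟨h1, -⟩ | ⟨-, hl⟩
    · exact absurd (hnb (solidGraph_adj_of_posStep huv he (hcsolid u hu) (hcsolid v hv) h1)
        (hLreach _ hnL u hu v hv)) hnL
    have hboth : upper u v ∈ F ∧ lower u v ∈ F := by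
      rw [mem_edges_iff huv] at he
      rw [mem_contour_iff huv] at hnc
      simp only [Xor] at hnc
      tauto
    have hU : s(u, v) ∈ (upper u v).sides := (mem_sides_iff huv _).2 (Or.inl rfl)
    have hW : s(u, v) ∈ (lower u v).sides := (mem_sides_iff huv _).2 (Or.inr rfl)
    obtain ⟨p, hvp, hpu, p1, p2⟩ := exists_third_corner huv hU
    obtain ⟨q, hvq, hqu, q1, q2⟩ := exists_third_corner huv hW
    obtain ⟨avp, apu⟩ := solidGraph_adj_of_loz hD hFD hA hB hab huv hvp hpu (hcsolid u hu)
      (hcsolid v hv) hl hboth.1 hU p1 p2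
    obtain ⟨avq, aqu⟩ := solidGraph_adj_of_loz hD hFD hA hB hab huv hvq hqu (hcsolid u hu)
      (hcsolid v hv) hl hboth.2 hW q1 q2
    have hpq : p ≠ q := by
      rintro rfl
      exact upper_ne_lower _ _ _ _ (eq_of_two_common_sides huv hvp hpu hU p1 hW q1)
    have huv' := huv.ne
    have l1 := hnb avp (reachable_deleteEdges_of_square apu aqu.symm avq.symm huv'.symm hpq)
    have l2 := hnb apu (reachable_deleteEdges_of_square aqu.symm avq.symm avp hpq huv')
    have l3 := hnb avq (reachable_deleteEdges_of_square aqu apu.symm avp.symm huv'.symm hpq.symm)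
    have l4 := hnb aqu (reachable_deleteEdges_of_square apu.symm avp.symm avq hpq.symm huv')
    have hlozF : loz u v = F := by
      refine eq_of_contour_subset ⟨upper u v, by simp [loz]⟩ ?_ hLcyc hdel
      intro e he'
      rw [hcontour]
      obtain ⟨t, ⟨ht, het⟩, hu⟩ := he'
      have hne : e ≠ s(u, v) := by
        rintro rfl
        exact upper_ne_lower u v u v ((hu _ ⟨by simp [loz], hU⟩).trans
          (hu _ ⟨by simp [loz], hW⟩).symm)
      have hthree : ∀ {w}, s(u, v) ∈ t.sides → s(v, w) ∈ t.sides → s(w, u) ∈ t.sides →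
          PosStep v w → PosStep w u → e = s(v, w) ∨ e = s(w, u) := by
        intro w h1 h2 h3 hvw hwu
        have hsub : ({s(u, v), s(v, w), s(w, u)} : Finset (Sym2 Vertex)) ⊆ t.sides := by
          simp [Finset.insert_subset_iff, h1, h2, h3]
        have hcard : t.sides.card ≤ ({s(u, v), s(v, w), s(w, u)} : Finset (Sym2 Vertex)).card := by
          have h3 : ({s(u, v), s(v, w), s(w, u)} : Finset (Sym2 Vertex)).card = 3 := by
            rw [Finset.card_eq_three]
            refine ⟨_, _, _, ?_, ?_, ?_, rfl⟩ <;> simp [huv.ne, hvw.ne, hwu.ne, huv.ne.symm,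
              hwu.ne.symm]
          rw [h3, Triangle.sides]
          split_ifs <;> exact Finset.card_le_three
        rw [← Finset.eq_of_subset_of_card_le hsub hcard] at het
        simpa [hne] using het
      simp only [loz, Finset.mem_insert, Finset.mem_singleton] at ht
      rcases ht with rfl | rfl
      · rcases hthree hU p1 p2 hvp hpu with rfl | rfl <;> assumption
      · rcases hthree hW q1 q2 hvq hqu with rfl | rfl <;> assumption
    rw [← hlozF]
    exact isLozenge_loz huv
  · left
    have hiff : ∀ u ∈ F.contourVertices, ∀ v ∈ F.contourVertices,
        s(u, v) ∈ F.edges ↔ s(u, v) ∈ F.contour := by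
      intro u hu v hv
      refine ⟨fun he => ?_, contour_subset_edges⟩
      by_contra hnc
      obtain ⟨u', v', heq, huv⟩ := exists_posStep_of_mem_edges he
      rcases Sym2.eq_iff.1 heq with ⟨rfl, rfl⟩ | ⟨rfl, rfl⟩
      · exact hchord ⟨_, _, huv, hu, hv, he, hnc⟩
      · rw [Sym2.eq_swap] at he hnc
        exact hchord ⟨_, _, huv, hv, hu, he, hnc⟩
    refine ⟨hsub, isConnected_of_isDelimitedBy hne hLcyc hdel, htile, ?_, hinterior, hiff⟩
    -- With every vertex on the contour, the diagonal of a tile would be a contour edge, although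
    -- both its triangles are in `F`.
    by_contra! hall
    obtain ⟨S, hS⟩ := htile
    obtain ⟨t, ht⟩ := hne
    obtain ⟨u, v, huv, hl, -⟩ := hS.exists_mem ht
    have h1 : upper u v ∈ F := hS.subset hl (by simp [loz])
    have h2 : lower u v ∈ F := hS.subset hl (by simp [loz])
    have he : s(u, v) ∈ F.edges := (mem_edges_iff huv).2 (Or.inl h1)
    have hc := (hiff u (hall u (mem_vertices_of_mem_edges he (by simp))) v
      (hall v (mem_vertices_of_mem_edges he (by simp)))).1 he
    rw [mem_contour_iff huv] at hc
    rcases hc with ⟨-, h⟩ | ⟨-, h⟩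
    exacts [h h2, h h1]

/-- A pre-fertile sub-domain that contains a fracture zone is equal to it. -/
lemma IsFractureZone.eq_of_isPreFertile {D F G : Domain} (hF : IsFractureZone D F)
    (hG : IsPreFertile D G) (hFG : F ⊆ G) : G = F := by
  obtain ⟨-, hne, x, L, ⟨-, hsolid⟩, hdel, -⟩ := hF
  obtain ⟨⟨-, T, -, v, C, ⟨-, hC, -⟩, hGC⟩, -, -, -, hint, hiff⟩ := hG
  have hCcyc := isCycle_of_isDelimitedBy (hne.mono hFG) hC hGC
  refine (eq_of_contour_subset hne ?_ hCcyc hGC).symm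
  intro e he
  have heG := edges_mono hFG (contour_subset_edges he)
  have heL : e ∈ L.edges := by
    rw [IsDelimitedBy] at hdel
    rwa [hdel, Set.mem_ofPred_eq] at he
  -- Ends of `e` are solid, hence not interior to `G`; the absence of chords then puts `e` on the
  -- contour of `G`.
  have hv : ∀ v ∈ e, v ∈ G.contourVertices := by
    intro v hve
    by_contra hvc
    exact hint v (mem_vertices_of_mem_edges heG hve) hvc
      (hsolid v (SimpleGraph.Walk.mem_support_of_mem_edges heL hve))
  induction e with
  | _ a b => exact (hiff a (hv a (by simp)) b (hv b (by simp))).1 heG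

end FractureZones

end Lozenge

theorem mainTheorem4 (D : Lozenge.Domain) (hD : Lozenge.IsTileable D)
    (hheight : Lozenge.HasConsistentHeights D) (F : Lozenge.Domain)
    (hF : Lozenge.IsFractureZone D F) :
    Lozenge.IsFertile D F ∨ Lozenge.IsLozenge F := by
  refine (hF.isPreFertile_or_isLozenge hheight).imp_left fun h => ⟨h, fun F' _ hG => ?_⟩
  exact hF.eq_of_isPreFertile hG Finset.subset_union_left
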